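/- **Setting.** All vector spaces are over $\mathbb C$. For $m\ge 1$ let $\mathbb C^m$ carry its canonical symmetric bilinear form $B$: with $p=\lfloor m/2\rfloor$ and the canonical basis written $E_1,\dots,E_p,F_1,\dots,F_p$ ($m$ even) or $E_1,\dots,E_p,G,F_1,\dots,F_p$ ($m$ odd), one has $B(E_i,F_j)=\delta_{ij}$, $B(E_i,E_j)=B(F_i,F_j)=0$ and, for $m$ odd, $B(E_i,G)=B(F_j,G)=0$, $B(G,G)=1$. Let $\mathrm O(m)$ be its isometry group and $\mathfrak o(m)$ the space of endomorphisms of $\mathbb C^m$ that are skew-symmetric with respect to $B$; $\mathrm O(m)$ acts on $\mathfrak o(m)$ by $U\cdot C=UCU^{-1}$. A quadratic Lie algebra $(\mathfrak g,B)$ is a Lie algebra with a non-degenerate symmetric bilinear form $B$ such that $B([X,Y],Z)=B(X,[Y,Z])$. It is *singular* if it is non-Abelian and $\dim\{\alpha\in\mathfrak g^*\mid \alpha\wedge I=0\}\ge 1$, where $I(X,Y,Z)=B([X,Y],Z)$. Two quadratic Lie algebras are *isomorphic* if they are isomorphic as Lie algebras, and *i-isomorphic* if there is a Lie algebra isomorphism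 between them that is an isometry. For $n\ge 1$ let $\mathcal N(n+2)$ be the set of nilpotent singular quadratic Lie algebra structures on the quadratic vector space $\mathbb C^{n+2}$, and let $\widehat{\mathcal N}(n+2)$ and $\widehat{\mathcal N}^{\mathrm i}(n+2)$ be the sets of isomorphism classes and of i-isomorphism classes of its elements. Let $\widetilde{\mathcal N}(n)$ be the set of $\mathrm O(n)$-orbits $\mathcal O_{\overline C}$ of *non-zero* nilpotent elements $\overline C\in\mathfrak o(n)$. For $\overline C\in\mathfrak o(n)$ the *double extension* $\mathfrak g_{\overline C}$ is the quadratic Lie algebra $\mathbb C^n\oplus\mathbb C X_1\oplus\mathbb C Y_1$, where $X_1,Y_1$ are isotropic and orthogonal to $\mathbb C^n$, $B(X_1,Y_1)=1$, and $$[X+\lambda X_1+\mu Y_1,\;Y+\lambda'X_1+\mu'Y_1]=\mu\,\overline C(Y)-\mu'\,\overline C(X)+B(\overline C(X),Y)\,X_1 .$$ **Proposition 5.2.** Let $n\ge1$. 1. For $\mathfrak g,\mathfrak g'\in\mathcal N(n+2)$, $\mathfrak g$ and $\mathfrak g'$ are isomorphic if and only if they are i-isomorphic. Thus the isomorphism class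 of $\mathfrak g$ in $\mathcal N(n+2)$ equals its i-isomorphism class, and $\widehat{\mathcal N}^{\mathrm i}(n+2)=\widehat{\mathcal N}(n+2)$. 2. For every non-zero nilpotent $\overline C\in\mathfrak o(n)$ the double extension $\mathfrak g_{\overline C}$ is i-isomorphic to an element of $\mathcal N(n+2)$. The map $\overline C\mapsto\mathfrak g_{\overline C}$ induces a well-defined bijection $\tau:\widetilde{\mathcal N}(n)\to\widehat{\mathcal N}(n+2)$: $\tau(\mathcal O_{\overline C})$ is the class of any element of $\mathcal N(n+2)$ that is i-isomorphic to $\mathfrak g_{\overline C}$. 3. The set $\widehat{\mathcal N}(n+2)$ is finite. -/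

import Mathlib

open LinearMap (BilinForm)

noncomputable section

/-- A quadratic Lie algebra structure on the complex vector space `V`: a non-degenerate symmetric
bilinear form, together with a Lie bracket for which the form is invariant. -/
structure QuadraticLieAlgebra (V : Type*) [AddCommGroup V] [Module ℂ V] where
  form : BilinForm ℂ V
  form_symm : form.IsSymm
  form_nondegenerate : form.Nondegenerate
  bracket : V →ₗ[ℂ] V →ₗ[ℂ] V
  bracket_self : ∀ x, bracket x x = 0
  jacobi : ∀ x y z, bracket x (bracket y z) = bracket (bracket x y) z + bracket y (bracket x z)
  invariant : ∀ x y z, form (bracket x y) z = form x (bracket y z)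

namespace QuadraticLieAlgebra

variable {V W : Type*} [AddCommGroup V] [Module ℂ V] [AddCommGroup W] [Module ℂ W]

/-- The vector space `V`, regarded as a Lie algebra with the bracket of `g`. -/
def Carrier (_g : QuadraticLieAlgebra V) : Type _ := V

instance (g : QuadraticLieAlgebra V) : AddCommGroup g.Carrier :=
  inferInstanceAs (AddCommGroup V)

instance (g : QuadraticLieAlgebra V) : Module ℂ g.Carrier :=
  inferInstanceAs (Module ℂ V)

instance (g : QuadraticLieAlgebra V) : LieRing g.Carrier where
  bracket x y := g.bracket x y
  add_lie x y z := by
    change g.bracket (x + y) z = g.bracket x z + g.bracket y z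
    exact g.bracket.map_add₂ x y z
  lie_add x y z := (g.bracket x).map_add y z
  lie_self := g.bracket_self
  leibniz_lie := g.jacobi

instance (g : QuadraticLieAlgebra V) : LieAlgebra ℂ g.Carrier where
  lie_smul c x y := (g.bracket x).map_smul c y

/-- The form of `g`, regarded as a bilinear form on the Lie algebra `g.Carrier`. -/
def carrierForm (g : QuadraticLieAlgebra V) : BilinForm ℂ g.Carrier := g.form

/-- Isomorphic as Lie algebras; the bilinear forms are ignored. -/
def Isomorphic (g : QuadraticLieAlgebra V) (h : QuadraticLieAlgebra W) : Prop :=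
  Nonempty (g.Carrier ≃ₗ⁅ℂ⁆ h.Carrier)

/-- Isometrically isomorphic: there is a Lie algebra isomorphism that is an isometry. -/
def IIsomorphic (g : QuadraticLieAlgebra V) (h : QuadraticLieAlgebra W) : Prop :=
  ∃ A : g.Carrier ≃ₗ⁅ℂ⁆ h.Carrier, ∀ x y, h.carrierForm (A x) (A y) = g.carrierForm x y

theorem bracket_swap (g : QuadraticLieAlgebra V) (x y : V) : g.bracket x y = -g.bracket y x := by
  have h := g.bracket_self (x + y)
  simp only [map_add, LinearMap.add_apply, g.bracket_self, zero_add, add_zero] at h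
  exact eq_neg_of_add_eq_zero_right h

/-- The canonical 3-form `I(X, Y, Z) = B([X, Y], Z)`. -/
def threeForm (g : QuadraticLieAlgebra V) : V [⋀^Fin 3]→ₗ[ℂ] ℂ where
  toFun v := g.form (g.bracket (v 0) (v 1)) (v 2)
  map_update_add' := by
    intro inst v i x y
    obtain rfl : inst = instDecidableEqFin 3 := Subsingleton.elim _ _
    have h20 : (2 : Fin 3) ≠ 0 := by decide
    have h21 : (2 : Fin 3) ≠ 1 := by decide
    have hi : i = 0 ∨ i = 1 ∨ i = 2 := by omega
    rcases hi with rfl | rfl | rfl <;> simp [h20, h21]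
  map_update_smul' := by
    intro inst v i c x
    obtain rfl : inst = instDecidableEqFin 3 := Subsingleton.elim _ _
    have h20 : (2 : Fin 3) ≠ 0 := by decide
    have h21 : (2 : Fin 3) ≠ 1 := by decide
    have hi : i = 0 ∨ i = 1 ∨ i = 2 := by omega
    rcases hi with rfl | rfl | rfl <;> simp [h20, h21]
  map_eq_zero_of_eq' := by
    have h01 : ∀ x z, g.form (g.bracket x x) z = 0 := fun x z => by simp [g.bracket_self]
    have h12 : ∀ x y, g.form (g.bracket x y) y = 0 := fun x y => by
      simp [g.invariant, g.bracket_self]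
    have h02 : ∀ x y, g.form (g.bracket x y) x = 0 := fun x y => by
      rw [g.bracket_swap, map_neg, LinearMap.neg_apply, h12, neg_zero]
    intro v i j hij hne
    fin_cases i <;> fin_cases j <;> simp_all

/-- The wedge product `α ∧ I` of a linear form and an alternating `3`-form:
`(α ∧ I)(v₀, …, v₃) = ∑ᵢ (-1)^i α(vᵢ) I(v₀, …, v̂ᵢ, …, v₃)`, as a linear map in `α`. -/
def wedgeThreeForm (I : V [⋀^Fin 3]→ₗ[ℂ] ℂ) : Module.Dual ℂ V →ₗ[ℂ] V [⋀^Fin 4]→ₗ[ℂ] ℂ where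
  toFun α := AlternatingMap.alternatizeUncurryFin (α.smulRight I)
  map_add' α β := by
    rw [← AlternatingMap.alternatizeUncurryFin_add]
    congr 1
    ext x v
    simp [add_mul]
  map_smul' c α := by
    rw [RingHom.id_apply, ← AlternatingMap.alternatizeUncurryFin_smul]
    congr 1
    ext x v
    simp [mul_assoc]

/-- The `dup`-number `dim {α ∈ g* | α ∧ I = 0}`. -/
def dup (g : QuadraticLieAlgebra V) : ℕ :=
  Module.finrank ℂ (LinearMap.ker (wedgeThreeForm g.threeForm))

/-- Singular: non-Abelian with `dup`-number at least `1`. -/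
def IsSingular (g : QuadraticLieAlgebra V) : Prop :=
  ¬ IsLieAbelian g.Carrier ∧ 1 ≤ g.dup

/-- The double extension of the quadratic vector space `(V, B)` by the skew-symmetric map `C`.
It lives on `V × ℂ × ℂ`; the triple `(X, a, b)` stands for `X + a X₁ + b Y₁`, where
`X₁`, `Y₁` are isotropic, orthogonal to `V`, and `B(X₁, Y₁) = 1`. The bracket is
`[X + a X₁ + b Y₁, Y + a' X₁ + b' Y₁] = b C(Y) - b' C(X) + B(C(X), Y) X₁`. -/
def doubleExtension (B : BilinForm ℂ V) (hs : B.IsSymm) (hn : B.Nondegenerate)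
    (C : B.skewAdjointSubmodule) : QuadraticLieAlgebra (V × ℂ × ℂ) where
  form := LinearMap.mk₂ ℂ
    (fun x y => B x.1 y.1 + x.2.1 * y.2.2 + x.2.2 * y.2.1)
    (by intro x y z; simp; ring) (by intro c x y; simp; ring)
    (by intro x y z; simp; ring) (by intro c x y; simp; ring)
  form_symm := ⟨by intro x y; simp [hs.eq x.1 y.1]; ring⟩
  form_nondegenerate := by
    constructor
    · rintro ⟨X, a, b⟩ h
      have hX : X = 0 := hn.1 X fun Y => by simpa using h (Y, 0, 0)
      have ha : a = 0 := by simpa using h (0, 0, 1)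
      have hb : b = 0 := by simpa using h (0, 1, 0)
      simp [hX, ha, hb]
    · rintro ⟨X, a, b⟩ h
      have hX : X = 0 := hn.2 X fun Y => by simpa using h (Y, 0, 0)
      have ha : a = 0 := by simpa using h (0, 0, 1)
      have hb : b = 0 := by simpa using h (0, 1, 0)
      simp [hX, ha, hb]
  bracket := LinearMap.mk₂ ℂ
    (fun x y => (x.2.2 • C.1 y.1 - y.2.2 • C.1 x.1, B (C.1 x.1) y.1, 0))
    (by intro x y z; ext1 <;> simp; module)
    (by intro c x y; ext1 <;> simp; module)
    (by intro x y z; ext1 <;> simp; module)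
    (by intro c x y; ext1 <;> simp; module)
  bracket_self := by
    intro x
    have h : B (C.1 x.1) x.1 = -B x.1 (C.1 x.1) := by
      simpa using (LinearMap.mem_skewAdjointSubmodule C.1).1 C.2 x.1 x.1
    rw [hs.eq x.1] at h
    have h0 : B (C.1 x.1) x.1 = 0 := self_eq_neg.1 h
    simp [h0]
  jacobi := by
    intro x y z
    have h : ∀ u v, B (C.1 u) v = -B u (C.1 v) := fun u v => by
      simpa using (LinearMap.mem_skewAdjointSubmodule C.1).1 C.2 u v
    have h' : ∀ u v, B (C.1 u) (C.1 v) = B (C.1 v) (C.1 u) := fun u v => hs.eq _ _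
    have h2 : ∀ u v, B (C.1 (C.1 u)) v = -B (C.1 u) (C.1 v) := fun u v => h _ _
    ext1
    · simp; module
    · ext1
      · simp [h2, h' y.1 x.1]; ring
      · simp
  invariant := by
    intro x y z
    have h : ∀ u v, B (C.1 u) v = -B u (C.1 v) := fun u v => by
      simpa using (LinearMap.mem_skewAdjointSubmodule C.1).1 C.2 u v
    simp [h]; ring

end QuadraticLieAlgebra

/-- With `p = n / 2`, the canonical basis of `ℂⁿ` is listed as `E₁, …, E_p, F₁, …, F_p` for even `n`
and as `E₁, …, E_p, G, F₁, …, F_p` for odd `n`. This involution of the index set interchanges the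
index of `Eᵢ` with that of `Fᵢ` and fixes the index of `G`. -/
def canonicalPairing (n : ℕ) (i : Fin n) : Fin n :=
  if h : (i : ℕ) < n / 2 then ⟨i + (n - n / 2), by omega⟩
  else if n - n / 2 ≤ (i : ℕ) then ⟨i - (n - n / 2), by omega⟩
  else i

theorem canonicalPairing_involutive (n : ℕ) : Function.Involutive (canonicalPairing n) := by
  intro i
  have hi := i.2
  apply Fin.ext
  unfold canonicalPairing
  by_cases h1 : (i : ℕ) < n / 2
  · have h2 : ¬ (i : ℕ) + (n - n / 2) < n / 2 := by omega
    simp [h1, h2]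
  · by_cases h2 : n - n / 2 ≤ (i : ℕ)
    · have h3 : (i : ℕ) - (n - n / 2) < n / 2 := by omega
      simp [h1, h2, h3]
    · simp [h1, h2]

/-- The canonical bilinear form on `ℂⁿ`: `B(Eᵢ, Fⱼ) = δᵢⱼ`, `B(Eᵢ, Eⱼ) = B(Fᵢ, Fⱼ) = 0` and, for
odd `n`, `B(Eᵢ, G) = B(Fⱼ, G) = 0`, `B(G, G) = 1`. -/
def canonicalForm (n : ℕ) : BilinForm ℂ (Fin n → ℂ) :=
  Matrix.toBilin' (Matrix.of fun i j => if canonicalPairing n i = j then 1 else 0)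

theorem canonicalForm_apply (n : ℕ) (x y : Fin n → ℂ) :
    canonicalForm n x y = ∑ i, x i * y (canonicalPairing n i) := by
  simp [canonicalForm, Matrix.toBilin'_apply]

theorem canonicalForm_isSymm (n : ℕ) : (canonicalForm n).IsSymm := by
  refine ⟨fun x y => ?_⟩
  rw [canonicalForm_apply, canonicalForm_apply,
    ← Equiv.sum_comp (canonicalPairing_involutive n).toPerm]
  refine Finset.sum_congr rfl fun i _ => ?_
  simp [canonicalPairing_involutive n i, mul_comm]

theorem canonicalForm_nondegenerate (n : ℕ) : (canonicalForm n).Nondegenerate := by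
  have key : ∀ x, (∀ y, canonicalForm n x y = 0) → x = 0 := by
    intro x h
    funext i
    have hi := h (Pi.single (canonicalPairing n i) 1)
    rw [canonicalForm_apply, Finset.sum_eq_single i] at hi
    · simpa using hi
    · intro j _ hj
      rw [Pi.single_eq_of_ne ((canonicalPairing_involutive n).injective.ne hj), mul_zero]
    · simp
  exact ⟨key, fun y h => key y fun x => by rw [(canonicalForm_isSymm n).eq]; exact h x⟩

/-- The set `𝒩(n)` of non-zero nilpotent elements of `𝔬(n)`, the space of endomorphisms of `ℂⁿ` that
are skew-symmetric for the canonical bilinear form. -/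
def NonzeroNilpotents (n : ℕ) : Set (canonicalForm n).skewAdjointSubmodule :=
  {C | C ≠ 0 ∧ IsNilpotent (C : Module.End ℂ (Fin n → ℂ))}

/-- The `O(n)`-adjoint orbit `{U C U⁻¹ | U ∈ O(n)}` of `C ∈ 𝔬(n)`. -/
def adjointOrbit (n : ℕ) (C : (canonicalForm n).skewAdjointSubmodule) :
    Set (canonicalForm n).skewAdjointSubmodule :=
  {C' | ∃ U : (Fin n → ℂ) ≃ₗ[ℂ] (Fin n → ℂ),
    (∀ x y, canonicalForm n (U x) (U y) = canonicalForm n x y) ∧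
    (C' : Module.End ℂ (Fin n → ℂ)) =
      U.toLinearMap ∘ₗ (C : Module.End ℂ (Fin n → ℂ)) ∘ₗ U.symm.toLinearMap}

/-- The set of `O(n)`-orbits of non-zero nilpotent elements of `𝔬(n)`. -/
def NilpotentOrbits (n : ℕ) : Set (Set (canonicalForm n).skewAdjointSubmodule) :=
  adjointOrbit n '' NonzeroNilpotents n

/-- The double extension of the quadratic vector space `ℂⁿ` by `C ∈ 𝔬(n)`. -/
def doubleExtensionOf (n : ℕ) (C : (canonicalForm n).skewAdjointSubmodule) :
    QuadraticLieAlgebra ((Fin n → ℂ) × ℂ × ℂ) :=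
  QuadraticLieAlgebra.doubleExtension (canonicalForm n) (canonicalForm_isSymm n)
    (canonicalForm_nondegenerate n) C

/-- The set of nilpotent singular quadratic Lie algebra structures on the quadratic vector space
`ℂᵐ` (with its canonical bilinear form). -/
def NilpotentSingular (m : ℕ) : Set (QuadraticLieAlgebra (Fin m → ℂ)) :=
  {g | g.form = canonicalForm m ∧ g.IsSingular ∧ LieRing.IsNilpotent g.Carrier}

/-- The isomorphism class `[g]` of `g` among the nilpotent singular structures on `ℂᵐ`. -/
def isoClass {m : ℕ} (g : NilpotentSingular m) : Set (NilpotentSingular m) :=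
  {h | g.1.Isomorphic h.1}

/-- The i-isomorphism class of `g` among the nilpotent singular structures on `ℂᵐ`. -/
def iIsoClass {m : ℕ} (g : NilpotentSingular m) : Set (NilpotentSingular m) :=
  {h | g.1.IIsomorphic h.1}

/-- The set of isomorphism classes of nilpotent singular structures on `ℂᵐ`. -/
def IsoClasses (m : ℕ) : Set (Set (NilpotentSingular m)) := Set.range isoClass

/-- The set of i-isomorphism classes of nilpotent singular structures on `ℂᵐ`. -/
def IIsoClasses (m : ℕ) : Set (Set (NilpotentSingular m)) := Set.range iIsoClass

end

/-! Everything reduces to ranks of powers of a skew map. If α ∧ I = 0 has a non-zero solution, then,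
under the dual pairing given by B, the solutions form a subset stable under all ad w; nilpotency
therefore supplies a central solution x. Centrality forces x to be isotropic. Choosing an isotropic
y with B(x, y) = 1 and evaluating α ∧ I at y shows that the whole bracket is encoded by ad y on the
orthogonal complement of x and y, so the algebra is a double extension by a non-zero nilpotent C
(`exists_iIsomorphic_doubleExtension`).

For k ≥ 1 the k-th term of the lower central series of a double extension has dimension rank(C^k) +
1 if C^k ≠ 0, and 0 otherwise. These dimensions do not involve the form, so a bare Lie isomorphism
already determines all ranks of powers (`mem_adjointOrbit_of_isomorphic`). Conversely, these ranks
determine a nilpotent map up to similarity (`exists_similar_of_finrank_range_pow_eq`), and similar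
skew maps are conjugate by an isometry (`exists_isometry_of_similar`). Conjugate maps have
i-isomorphic double extensions, which closes the circle. Finiteness follows because only finitely
many rank sequences exist. -/

noncomputable section

/-! ### Polynomial square roots of invertible endomorphisms. -/

section SquareRoot

open Polynomial

/-- Roots are added one at a time, repetitions allowed. If p² - X = q h, replacing p by p + t q
changes the cofactor h into h + 2tp + t²q, and t is chosen so that this vanishes at the new root a.
-/
theorem exists_prod_X_sub_C_dvd_sq_sub_X (s : Multiset ℂ) (hs : (0 : ℂ) ∉ s) :
    ∃ p : ℂ[X], (s.map fun a => X - C a).prod ∣ p ^ 2 - X := by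
  induction s using Multiset.induction_on with
  | empty => exact ⟨0, by simp⟩
  | cons a s ih =>
    simp only [Multiset.mem_cons, not_or] at hs
    obtain ⟨p, h, hp⟩ := ih hs.2
    rw [Multiset.map_cons, Multiset.prod_cons]
    set q := (s.map fun a => X - C a).prod
    have hpa := congrArg (eval a) hp
    simp only [eval_sub, eval_pow, eval_X, eval_mul] at hpa
    have ht : ∃ t : ℂ, eval a h + 2 * t * eval a p + t ^ 2 * eval a q = 0 := by
      -- If q(a) = 0 the equation for t is linear, and p(a)² = a ≠ 0 makes it solvable. Otherwise it
      -- is a genuine quadratic, and d is a square root of a quarter of its discriminant.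
      by_cases hq : eval a q = 0
      · have hp0 : eval a p ≠ 0 := by
          intro h0
          rw [h0, hq] at hpa
          exact hs.1 (by linear_combination hpa)
        refine ⟨-eval a h / (2 * eval a p), ?_⟩
        rw [hq]
        field_simp
        ring
      · obtain ⟨d, hd⟩ := IsAlgClosed.exists_pow_nat_eq (k := ℂ)
          (eval a p ^ 2 - eval a q * eval a h) (n := 2) (by norm_num)
        refine ⟨(d - eval a p) / eval a q, ?_⟩
        field_simp
        linear_combination hd
    obtain ⟨t, ht⟩ := ht
    have hroot : X - C a ∣ h + 2 * C t * p + C t ^ 2 * q := by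
      rw [dvd_iff_isRoot, IsRoot.def]
      simpa using ht
    refine ⟨p + C t * q, ?_⟩
    have : (p + C t * q) ^ 2 - X = (h + 2 * C t * p + C t ^ 2 * q) * q := by
      linear_combination hp
    rw [this]
    exact mul_dvd_mul_right hroot q

/-- An invertible endomorphism of a finite-dimensional complex vector space has a square root that
is a polynomial in it. -/
theorem exists_aeval_sq_eq {V : Type*} [AddCommGroup V] [Module ℂ V] [FiniteDimensional ℂ V]
    (T : Module.End ℂ V) (hT : Function.Injective T) : ∃ p : ℂ[X], aeval T p ^ 2 = T := by
  have hint : IsIntegral ℂ T := Algebra.IsIntegral.isIntegral T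
  have h0 : (0 : ℂ) ∉ (minpoly ℂ T).roots := by
    intro h
    have := Module.End.hasEigenvalue_of_isRoot (Polynomial.isRoot_of_mem_roots h)
    obtain ⟨v, hv⟩ := this.exists_hasEigenvector
    have hv' := hv.apply_eq_smul
    rw [zero_smul] at hv'
    exact hv.2 (hT (by rw [hv', map_zero]))
  obtain ⟨p, hp⟩ := exists_prod_X_sub_C_dvd_sq_sub_X _ h0
  rw [← (IsAlgClosed.splits (minpoly ℂ T)).eq_prod_roots_of_monic (minpoly.monic hint)] at hp
  refine ⟨p, ?_⟩
  have := minpoly.dvd_iff.1 hp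
  simpa [sub_eq_zero] using this

end SquareRoot

/-! ### Isometries: polar decomposition and uniqueness of non-degenerate forms. -/

section Isometry

variable {V W : Type*} [AddCommGroup V] [Module ℂ V] [FiniteDimensional ℂ V]
  [AddCommGroup W] [Module ℂ W] [FiniteDimensional ℂ W]

/-- Similar skew-adjoint endomorphisms are conjugate under the isometry group. -/
theorem exists_isometry_of_similar {B : BilinForm ℂ V} (hs : B.IsSymm) (hn : B.Nondegenerate)
    {C C' : Module.End ℂ V} (hC : ∀ x y, B (C x) y = -B x (C y))
    (hC' : ∀ x y, B (C' x) y = -B x (C' y)) (P : V ≃ₗ[ℂ] V) (hP : ∀ x, P (C x) = C' (P x)) :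
    ∃ U : V ≃ₗ[ℂ] V, (∀ x y, B (U x) (U y) = B x y) ∧ ∀ x, U (C x) = C' (U x) := by
  let B' : BilinForm ℂ V := B.compl₁₂ P.toLinearMap P.toLinearMap
  -- S is P*P, with P* the B-adjoint of P. A square root Q of S that is a polynomial in S inherits
  -- self-adjointness and commutation with C, so the polar factor U = P Q⁻¹ is an isometry that
  -- still intertwines C and C'.
  let S : Module.End ℂ V := B'.symmCompOfNondegenerate B hn
  have hS : ∀ x y, B (S x) y = B (P x) (P y) := fun x y =>
    LinearMap.BilinForm.symmCompOfNondegenerate_left_apply B' hn y x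
  have hinj : Function.Injective S := by
    rw [injective_iff_map_eq_zero]
    intro x hx
    have : P x = 0 := hn.1 _ fun y => by
      rw [← P.apply_symm_apply y, ← hS, hx, map_zero, LinearMap.zero_apply]
    simpa using this
  have hadj : ∀ x y, B (S x) y = B x (S y) := fun x y => by
    rw [hS, hs.eq, ← hS, hs.eq]
  have hcomm : Commute S C := by
    refine LinearMap.ext fun x => ?_
    rw [← sub_eq_zero]
    refine hn.1 _ fun y => ?_
    simp only [Module.End.mul_apply, map_sub, LinearMap.sub_apply, hS, hP, hC, hC']
    ring
  obtain ⟨p, hp⟩ := exists_aeval_sq_eq S hinj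
  set Q := Polynomial.aeval S p with hQ
  have hQQ : ∀ x, Q (Q x) = S x := fun x => by
    rw [← Module.End.mul_apply, ← sq, hp]
  have hQadj : ∀ x y, B (Q x) y = B x (Q y) := by
    rw [hQ]
    clear hp hQQ hQ
    induction p using Polynomial.induction_on' with
    | add p q h1 h2 => intro x y; simp [h1, h2]
    | monomial k a =>
      have hk : ∀ x y, B ((S ^ k) x) y = B x ((S ^ k) y) := by
        induction k with
        | zero => simp
        | succ k ih =>
          intro x y
          rw [pow_succ, Module.End.mul_apply, ih, hadj, ← Module.End.mul_apply, ← pow_succ',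
            pow_succ]
      intro x y
      simp [Polynomial.aeval_monomial, Module.algebraMap_end_apply, hk]
  have hQcomm : Commute Q C := by
    rw [hQ]
    clear hp hQQ hQadj hQ
    induction p using Polynomial.induction_on' with
    | add p q h1 h2 => rw [map_add]; exact h1.add_left h2
    | monomial k a =>
      rw [Polynomial.aeval_monomial]
      exact (Algebra.commute_algebraMap_left a C).mul_left (hcomm.pow_left k)
  have hQinj : Function.Injective Q := by
    intro x y h
    apply hinj
    rw [← hQQ, ← hQQ, h]
  let Qe : V ≃ₗ[ℂ] V := LinearEquiv.ofInjectiveEndo Q hQinj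
  have hQe : ∀ x, Q (Qe.symm x) = x := fun x => Qe.apply_symm_apply x
  refine ⟨Qe.symm.trans P, fun x y => ?_, fun x => ?_⟩
  · simp only [LinearEquiv.trans_apply]
    rw [← hS, ← hQQ, hQadj, hQe, hQe]
  · simp only [LinearEquiv.trans_apply]
    rw [← hP]
    congr 1
    apply hQinj
    rw [hQe, ← Module.End.mul_apply, hQcomm.eq, Module.End.mul_apply, hQe]

/-- Non-degenerate symmetric bilinear forms on complex vector spaces of the same dimension are
isometric. -/
theorem exists_isometry_of_finrank_eq {B₁ : BilinForm ℂ V} {B₂ : BilinForm ℂ W}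
    (hs₁ : B₁.IsSymm) (hn₁ : B₁.Nondegenerate) (hs₂ : B₂.IsSymm) (hn₂ : B₂.Nondegenerate)
    (h : Module.finrank ℂ V = Module.finrank ℂ W) :
    ∃ e : V ≃ₗ[ℂ] W, ∀ x y, B₂ (e x) (e y) = B₁ x y := by
  let f : V ≃ₗ[ℂ] W := LinearEquiv.ofFinrankEq V W h
  let B₃ : BilinForm ℂ V := B₂.compl₁₂ f.toLinearMap f.toLinearMap
  have hs₃ : B₃.IsSymm := ⟨fun x y => hs₂.eq _ _⟩
  have hn₃ : B₃.SeparatingLeft := fun x hx => by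
    have : f x = 0 := hn₂.1 _ fun y => by simpa [B₃] using hx (f.symm y)
    simpa using this
  have key : ∀ {B : BilinForm ℂ V}, B.IsSymm →
      QuadraticMap.associated (R := ℂ) (B.toQuadraticMap : QuadraticForm ℂ V) = B :=
    fun {B} hB => QuadraticMap.associated_left_inverse ℂ hB.eq
  obtain ⟨u⟩ := QuadraticForm.equivalent_of_isAlgClosed (K := ℂ)
    (B₁.toQuadraticMap : QuadraticForm ℂ V) B₃.toQuadraticMap
    (by rw [key hs₁]; exact hn₁.1) (by rw [key hs₃]; exact hn₃)
  -- The map u preserves only the quadratic forms; polarization recovers the bilinear ones.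
  refine ⟨u.toLinearEquiv.trans f, fun x y => ?_⟩
  have hu : ∀ z, B₃ (u z) (u z) = B₁ z z := fun z => u.map_app z
  have h1 := hu (x + y)
  simp only [map_add, LinearMap.add_apply, hu] at h1
  rw [hs₃.eq (u y) (u x), hs₁.eq y x] at h1
  change B₃ (u x) (u y) = B₁ x y
  linear_combination h1 / 2

end Isometry

/-! ### Nilpotent endomorphisms are classified by the ranks of their powers. -/

section NilpotentSimilarity

open Polynomial

section Chain

variable {V : Type*} [AddCommGroup V] [Module ℂ V]

/-- The map `p ↦ p(C) x` onto the cyclic subspace generated by `x`. -/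
def cyclicMap (C : Module.End ℂ V) (x : V) : ℂ[X] →ₗ[ℂ] V :=
  (LinearMap.applyₗ x) ∘ₗ (aeval C).toLinearMap

theorem cyclicMap_apply (C : Module.End ℂ V) (x : V) (p : ℂ[X]) :
    cyclicMap C x p = aeval C p x := rfl

theorem cyclicMap_X_mul (C : Module.End ℂ V) (x : V) (p : ℂ[X]) :
    cyclicMap C x (X * p) = C (cyclicMap C x p) := by
  simp [cyclicMap_apply]

theorem cyclicMap_X_pow_mul (C : Module.End ℂ V) (x : V) (k : ℕ) (p : ℂ[X]) :
    cyclicMap C x (X ^ k * p) = (C ^ k) (cyclicMap C x p) := by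
  simp [cyclicMap_apply]

theorem cyclicMap_eq_zero_of_dvd {C : Module.End ℂ V} {m : ℕ} (hm : C ^ m = 0) (x : V)
    {p : ℂ[X]} (h : X ^ m ∣ p) : cyclicMap C x p = 0 := by
  obtain ⟨q, rfl⟩ := h
  simp [cyclicMap_apply, hm]

/-- If d ≤ m is the lowest degree occurring in p, then C^(m-d) pushes that term to the end of the
chain and all higher terms past it. -/
theorem exists_pow_cyclicMap_eq_smul {C : Module.End ℂ V} {m : ℕ} (hm : C ^ (m + 1) = 0) (x : V)
    {p : ℂ[X]} (h : ¬ X ^ (m + 1) ∣ p) :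
    ∃ (k : ℕ) (c : ℂ), c ≠ 0 ∧ (C ^ k) (cyclicMap C x p) = c • (C ^ m) x := by
  classical
  rw [X_pow_dvd_iff] at h
  push Not at h
  obtain ⟨d, ⟨hd, hc⟩, hfind⟩ : ∃ d, (d < m + 1 ∧ p.coeff d ≠ 0) ∧
      ∀ j < d, ¬ (j < m + 1 ∧ p.coeff j ≠ 0) :=
    ⟨Nat.find h, Nat.find_spec h, fun j hj => Nat.find_min h hj⟩
  have hmin : ∀ j < d, p.coeff j = 0 := fun j hj => by
    by_contra hj'
    exact hfind j hj ⟨by omega, hj'⟩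
  obtain ⟨q, rfl⟩ := X_pow_dvd_iff.2 hmin
  have hc' : q.coeff 0 ≠ 0 := by
    have := coeff_X_pow_mul q d 0
    rw [zero_add] at this
    rwa [this] at hc
  refine ⟨m - d, q.coeff 0, hc', ?_⟩
  rw [← cyclicMap_X_pow_mul, ← mul_assoc, ← pow_add, Nat.sub_add_cancel (by omega)]
  conv_lhs => rw [← X_mul_divX_add q]
  rw [mul_add, map_add, ← mul_assoc, ← pow_succ,
    cyclicMap_eq_zero_of_dvd hm x (Dvd.intro _ rfl), zero_add, mul_comm, cyclicMap_apply]
  simp [Module.algebraMap_end_apply]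

theorem ker_cyclicMap {C : Module.End ℂ V} {m : ℕ} (hm : C ^ (m + 1) = 0) {x : V}
    (hx : (C ^ m) x ≠ 0) (p : ℂ[X]) : cyclicMap C x p = 0 ↔ X ^ (m + 1) ∣ p := by
  refine ⟨fun h => ?_, cyclicMap_eq_zero_of_dvd hm x⟩
  by_contra hp
  obtain ⟨k, c, hc, hk⟩ := exists_pow_cyclicMap_eq_smul hm x hp
  rw [h, map_zero] at hk
  exact smul_ne_zero hc hx hk.symm

/-- A cyclic subspace of maximal length has an invariant complement. -/
theorem exists_isCompl_range_cyclicMap {C : Module.End ℂ V} {m : ℕ} (hm : C ^ (m + 1) = 0) {x : V}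
    (hx : (C ^ m) x ≠ 0) :
    ∃ U : Submodule ℂ V, IsCompl (LinearMap.range (cyclicMap C x)) U ∧ ∀ u ∈ U, C u ∈ U := by
  obtain ⟨g, hg⟩ : ∃ g : Module.Dual ℂ V, g ((C ^ m) x) ≠ 0 := by
    by_contra! h
    exact hx ((Module.forall_dual_apply_eq_zero_iff ℂ _).1 h)
  have hCz : ∀ i, m < i → C ^ i = 0 := fun i hi => pow_eq_zero_of_le hi hm
  have hmem : ∀ k, (C ^ k) x ∈ LinearMap.range (cyclicMap C x) := fun k =>
    ⟨X ^ k, by simp [cyclicMap_apply]⟩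
  -- The complement is the largest C-invariant subspace of ker g. It misses the chain because a
  -- power of C sends any non-zero chain vector to a non-zero multiple of C^m x, where g does not
  -- vanish.
  refine ⟨⨅ i : ℕ, LinearMap.ker (g ∘ₗ C ^ i), ⟨?_, ?_⟩, fun u hu => ?_⟩
  · rw [Submodule.disjoint_def]
    rintro _ ⟨p, rfl⟩ hp
    simp only [Submodule.mem_iInf, LinearMap.mem_ker, LinearMap.comp_apply] at hp
    rw [ker_cyclicMap hm hx]
    by_contra hdvd
    obtain ⟨k, c, hc, hk⟩ := exists_pow_cyclicMap_eq_smul hm x hdvd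
    have := hp k
    rw [hk, map_smul, smul_eq_mul] at this
    exact mul_ne_zero hc hg this
  · rw [codisjoint_iff, eq_top_iff]
    rintro v -
    -- Triangular elimination: subtracting a multiple of C^k x kills the condition i = m - k and
    -- leaves those with i > m - k intact, since C^(i+k) = 0 there.
    have key : ∀ k ≤ m + 1, ∃ w ∈ LinearMap.range (cyclicMap C x),
        ∀ i, m < i + k → g ((C ^ i) (v - w)) = 0 := by
      intro k
      induction k with
      | zero => exact fun _ => ⟨0, zero_mem _, fun i hi => by simp [hCz i (by omega)]⟩
      | succ k ih =>
        intro hk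
        obtain ⟨w, hw, h⟩ := ih (by omega)
        set c := g ((C ^ (m - k)) (v - w)) / g ((C ^ m) x)
        refine ⟨w + c • (C ^ k) x, add_mem hw (Submodule.smul_mem _ _ (hmem k)), fun i hi => ?_⟩
        rw [← sub_sub, map_sub, map_sub, map_smul, map_smul, ← Module.End.mul_apply, ← pow_add]
        by_cases hik : m < i + k
        · rw [h i hik, hCz _ hik]
          simp
        · obtain rfl : i = m - k := by omega
          rw [Nat.sub_add_cancel (by omega), smul_eq_mul, div_mul_cancel₀ _ hg, sub_self]
    obtain ⟨w, hw, h⟩ := key (m + 1) le_rfl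
    rw [← add_sub_cancel w v]
    refine Submodule.add_mem_sup hw ?_
    simp only [Submodule.mem_iInf, LinearMap.mem_ker, LinearMap.comp_apply]
    exact fun i => h i (by omega)
  · simp only [Submodule.mem_iInf, LinearMap.mem_ker, LinearMap.comp_apply] at hu ⊢
    intro i
    rw [← Module.End.mul_apply, ← pow_succ]
    exact hu (i + 1)

end Chain

section Rank

variable {V W : Type*} [AddCommGroup V] [Module ℂ V] [AddCommGroup W] [Module ℂ W]

theorem map_pow_of_intertwines {F : Type*} [FunLike F V W] (e : F) {C : Module.End ℂ V}
    {D : Module.End ℂ W} (h : ∀ x, e (C x) = D (e x)) (k : ℕ) (x : V) :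
    e ((C ^ k) x) = (D ^ k) (e x) := by
  induction k generalizing x with
  | zero => simp
  | succ k ih => rw [pow_succ, pow_succ, Module.End.mul_apply, Module.End.mul_apply, ih, h]

theorem finrank_range_pow_of_intertwines (e : V ≃ₗ[ℂ] W) {C : Module.End ℂ V}
    {D : Module.End ℂ W} (h : ∀ x, e (C x) = D (e x)) (k : ℕ) :
    Module.finrank ℂ (LinearMap.range (C ^ k)) = Module.finrank ℂ (LinearMap.range (D ^ k)) := by
  have : LinearMap.range (D ^ k) = (LinearMap.range (C ^ k)).map e.toLinearMap := by
    ext y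
    constructor
    · rintro ⟨z, rfl⟩
      exact ⟨(C ^ k) (e.symm z), ⟨_, rfl⟩, by simp [map_pow_of_intertwines e h]⟩
    · rintro ⟨_, ⟨z, rfl⟩, rfl⟩
      exact ⟨e z, by simp [map_pow_of_intertwines e h]⟩
  rw [this]
  exact (LinearEquiv.finrank_map_eq e _).symm

theorem finrank_submodule_prod [FiniteDimensional ℂ V] [FiniteDimensional ℂ W]
    (p : Submodule ℂ V) (q : Submodule ℂ W) :
    Module.finrank ℂ (p.prod q) = Module.finrank ℂ p + Module.finrank ℂ q := by
  have h : p.prod q = LinearMap.range (p.subtype.prodMap q.subtype) := by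
    rw [LinearMap.range_prodMap, Submodule.range_subtype, Submodule.range_subtype]
  rw [h, LinearMap.finrank_range_of_inj (p.subtype_injective.prodMap q.subtype_injective),
    Module.finrank_prod]

theorem finrank_range_prodMap_pow [FiniteDimensional ℂ V] [FiniteDimensional ℂ W]
    (C : Module.End ℂ V) (D : Module.End ℂ W) (k : ℕ) :
    Module.finrank ℂ (LinearMap.range (C.prodMap D ^ k)) =
      Module.finrank ℂ (LinearMap.range (C ^ k)) + Module.finrank ℂ (LinearMap.range (D ^ k)) := by
  have : C.prodMap D ^ k = (C ^ k).prodMap (D ^ k) := by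
    refine LinearMap.ext fun x => Prod.ext ?_ ?_
    · exact (map_pow_of_intertwines (LinearMap.fst ℂ V W) (fun _ => rfl) k x)
    · exact (map_pow_of_intertwines (LinearMap.snd ℂ V W) (fun _ => rfl) k x)
  rw [this, LinearMap.range_prodMap, finrank_submodule_prod]

theorem pow_eq_zero_iff_of_finrank_range [FiniteDimensional ℂ V] {C : Module.End ℂ V} {k : ℕ} :
    C ^ k = 0 ↔ Module.finrank ℂ (LinearMap.range (C ^ k)) = 0 := by
  rw [Submodule.finrank_eq_zero, LinearMap.range_eq_bot]

end Rank

/-- Nilpotent endomorphisms all of whose powers have equal ranks are similar. -/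
theorem exists_similar_of_finrank_range_pow_eq {V W : Type*} [AddCommGroup V] [Module ℂ V]
    [FiniteDimensional ℂ V] [AddCommGroup W] [Module ℂ W] [FiniteDimensional ℂ W]
    {C : Module.End ℂ V} {D : Module.End ℂ W} (hC : IsNilpotent C)
    (h : ∀ k, Module.finrank ℂ (LinearMap.range (C ^ k)) =
      Module.finrank ℂ (LinearMap.range (D ^ k))) :
    ∃ e : V ≃ₗ[ℂ] W, ∀ x, e (C x) = D (e x) := by
  induction hN : Module.finrank ℂ V using Nat.strong_induction_on generalizing V W with
  | h N ih =>
  have hdim : Module.finrank ℂ V = Module.finrank ℂ W := by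
    have := h 0
    rwa [pow_zero, pow_zero, Module.End.one_eq_id, Module.End.one_eq_id, LinearMap.range_id,
      LinearMap.range_id, finrank_top, finrank_top] at this
  rcases subsingleton_or_nontrivial V with hV | hV
  · have : Subsingleton W := by
      rw [← Module.finrank_zero_iff (R := ℂ), ← hdim, Module.finrank_zero_iff]
      exact hV
    exact ⟨LinearEquiv.ofFinrankEq V W hdim, fun x => Subsingleton.elim _ _⟩
  obtain ⟨m, hm⟩ : ∃ m, nilpotencyClass C = m + 1 :=
    Nat.exists_eq_succ_of_ne_zero (pos_nilpotencyClass_iff.2 hC).ne'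
  have hm0 : C ^ m ≠ 0 := by
    have := pow_pred_nilpotencyClass hC
    rwa [hm, Nat.add_sub_cancel] at this
  have hm1 : C ^ (m + 1) = 0 := hm ▸ pow_nilpotencyClass hC
  have hD0 : D ^ m ≠ 0 := by
    rwa [ne_eq, pow_eq_zero_iff_of_finrank_range, ← h, ← pow_eq_zero_iff_of_finrank_range]
  have hD1 : D ^ (m + 1) = 0 := by
    rwa [pow_eq_zero_iff_of_finrank_range, ← h, ← pow_eq_zero_iff_of_finrank_range]
  obtain ⟨x, hx⟩ : ∃ x, (C ^ m) x ≠ 0 := by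
    by_contra! h'
    exact hm0 (LinearMap.ext h')
  obtain ⟨y, hy⟩ : ∃ y, (D ^ m) y ≠ 0 := by
    by_contra! h'
    exact hD0 (LinearMap.ext h')
  obtain ⟨U, hU, hCU⟩ := exists_isCompl_range_cyclicMap hm1 hx
  obtain ⟨U', hU', hDU'⟩ := exists_isCompl_range_cyclicMap hD1 hy
  have hCR : ∀ v ∈ LinearMap.range (cyclicMap C x), C v ∈ LinearMap.range (cyclicMap C x) := by
    rintro _ ⟨p, rfl⟩
    exact ⟨X * p, cyclicMap_X_mul C x p⟩
  have hDR : ∀ v ∈ LinearMap.range (cyclicMap D y), D v ∈ LinearMap.range (cyclicMap D y) := by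
    rintro _ ⟨p, rfl⟩
    exact ⟨X * p, cyclicMap_X_mul D y p⟩
  -- Both kernels are the ideal generated by X^(m+1), so both chains are copies of the same quotient
  -- of ℂ[X].
  have hker : LinearMap.ker (cyclicMap C x) = LinearMap.ker (cyclicMap D y) := by
    ext p
    rw [LinearMap.mem_ker, LinearMap.mem_ker, ker_cyclicMap hm1 hx, ker_cyclicMap hD1 hy]
  let r : LinearMap.range (cyclicMap C x) ≃ₗ[ℂ] LinearMap.range (cyclicMap D y) :=
    (LinearMap.quotKerEquivRange _).symm ≪≫ₗ Submodule.quotEquivOfEq _ _ hker ≪≫ₗ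
      LinearMap.quotKerEquivRange _
  have hr : ∀ (v : LinearMap.range (cyclicMap C x)) p, (v : V) = cyclicMap C x p →
      (r v : W) = cyclicMap D y p := by
    rintro ⟨_, hp⟩ p rfl
    have : (LinearMap.quotKerEquivRange (cyclicMap C x)).symm ⟨cyclicMap C x p, hp⟩ =
        Submodule.Quotient.mk p := LinearMap.quotKerEquivRange_symm_apply_image _ _ hp
    simp only [r, LinearEquiv.trans_apply, this]
    rfl
  have hrC : ∀ v, r (C.restrict hCR v) = D.restrict hDR (r v) := by
    intro v
    obtain ⟨p, hp⟩ := v.2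
    refine Subtype.ext ?_
    rw [hr (C.restrict hCR v) (X * p) (by rw [cyclicMap_X_mul, hp, LinearMap.coe_restrict_apply]),
      LinearMap.coe_restrict_apply, hr v p hp.symm, cyclicMap_X_mul]
  let e := Submodule.prodEquivOfIsCompl _ _ hU
  let e' := Submodule.prodEquivOfIsCompl _ _ hU'
  have he : ∀ v, e ((C.restrict hCR).prodMap (C.restrict hCU) v) = C (e v) := fun v => by
    simp [e]
  have he' : ∀ v, e' ((D.restrict hDR).prodMap (D.restrict hDU') v) = D (e' v) := fun v => by
    simp [e']
  -- Ranks add over the invariant splittings and agree on the chains, so they agree on the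
  -- complements, where induction applies.
  have hrank : ∀ k, Module.finrank ℂ (LinearMap.range (C.restrict hCU ^ k)) =
      Module.finrank ℂ (LinearMap.range (D.restrict hDU' ^ k)) := by
    intro k
    have h1 := finrank_range_pow_of_intertwines e he k
    have h2 := finrank_range_pow_of_intertwines e' he' k
    rw [finrank_range_prodMap_pow] at h1 h2
    have h3 := finrank_range_pow_of_intertwines r hrC k
    have h4 := h k
    omega
  have hnil : IsNilpotent (C.restrict hCU) := by
    refine ⟨m + 1, LinearMap.ext fun u => Subtype.ext ?_⟩
    have := map_pow_of_intertwines U.subtype (C := C.restrict hCU) (D := C) (fun _ => rfl) (m + 1) u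
    simpa [hm1] using this
  have hlt : Module.finrank ℂ U < N := by
    rw [← hN, ← Submodule.finrank_add_eq_of_isCompl hU]
    have : 0 < Module.finrank ℂ (LinearMap.range (cyclicMap C x)) := by
      rw [Module.finrank_pos_iff, Submodule.nontrivial_iff_ne_bot]
      intro hbot
      have h1 : (C ^ m) x ∈ LinearMap.range (cyclicMap C x) := ⟨X ^ m, by simp [cyclicMap_apply]⟩
      rw [hbot, Submodule.mem_bot] at h1
      exact hx h1
    omega
  obtain ⟨s, hs⟩ := ih _ hlt hnil hrank rfl
  refine ⟨e.symm ≪≫ₗ r.prodCongr s ≪≫ₗ e', fun v => ?_⟩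
  obtain ⟨w, rfl⟩ := e.surjective v
  rw [← he]
  simp only [LinearEquiv.trans_apply, LinearEquiv.symm_apply_apply]
  rw [← he']
  congr 1
  exact Prod.ext (hrC w.1) (hs w.2)

end NilpotentSimilarity

namespace QuadraticLieAlgebra

variable {U V W : Type*} [AddCommGroup U] [Module ℂ U] [AddCommGroup V] [Module ℂ V]
  [AddCommGroup W] [Module ℂ W]

/-! ### Isomorphisms and transport of structure. -/

section Isomorphism

theorem isomorphic_iff {g : QuadraticLieAlgebra V} {h : QuadraticLieAlgebra W} :
    g.Isomorphic h ↔ ∃ e : V ≃ₗ[ℂ] W, ∀ x y, e (g.bracket x y) = h.bracket (e x) (e y) := by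
  constructor
  · rintro ⟨A⟩
    exact ⟨A.toLinearEquiv, fun x y => LieEquiv.map_lie A (x : g.Carrier) y⟩
  · rintro ⟨e, he⟩
    let e' : g.Carrier ≃ₗ[ℂ] h.Carrier := e
    exact ⟨{ e' with map_lie' := fun {x y} => he x y }⟩

theorem iIsomorphic_iff {g : QuadraticLieAlgebra V} {h : QuadraticLieAlgebra W} :
    g.IIsomorphic h ↔ ∃ e : V ≃ₗ[ℂ] W, (∀ x y, e (g.bracket x y) = h.bracket (e x) (e y)) ∧
      ∀ x y, h.form (e x) (e y) = g.form x y := by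
  constructor
  · rintro ⟨A, hA⟩
    exact ⟨A.toLinearEquiv, fun x y => LieEquiv.map_lie A (x : g.Carrier) y, hA⟩
  · rintro ⟨e, he, hB⟩
    let e' : g.Carrier ≃ₗ[ℂ] h.Carrier := e
    exact ⟨{ e' with map_lie' := fun {x y} => he x y }, hB⟩

theorem IIsomorphic.isomorphic {g : QuadraticLieAlgebra V} {h : QuadraticLieAlgebra W}
    (H : g.IIsomorphic h) : g.Isomorphic h := ⟨H.choose⟩

theorem IIsomorphic.symm {g : QuadraticLieAlgebra V} {h : QuadraticLieAlgebra W}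
    (H : g.IIsomorphic h) : h.IIsomorphic g := by
  rw [iIsomorphic_iff] at H ⊢
  obtain ⟨e, he, hB⟩ := H
  refine ⟨e.symm, fun x y => ?_, fun x y => ?_⟩
  · apply e.injective
    simp [he]
  · simp [← hB]

theorem IIsomorphic.trans {f : QuadraticLieAlgebra U} {g : QuadraticLieAlgebra V}
    {h : QuadraticLieAlgebra W} (H : f.IIsomorphic g) (H' : g.IIsomorphic h) :
    f.IIsomorphic h := by
  rw [iIsomorphic_iff] at H H' ⊢
  obtain ⟨e, he, hB⟩ := H
  obtain ⟨e', he', hB'⟩ := H'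
  exact ⟨e.trans e', fun x y => by simp [he, he'], fun x y => by simp [hB, hB']⟩

theorem Isomorphic.symm {g : QuadraticLieAlgebra V} {h : QuadraticLieAlgebra W}
    (H : g.Isomorphic h) : h.Isomorphic g := H.map LieEquiv.symm

theorem Isomorphic.trans {f : QuadraticLieAlgebra U} {g : QuadraticLieAlgebra V}
    {h : QuadraticLieAlgebra W} (H : f.Isomorphic g) (H' : g.Isomorphic h) :
    f.Isomorphic h := H.elim fun A => H'.elim fun B => ⟨A.trans B⟩

/-- Transport of a quadratic Lie algebra structure along a linear equivalence. -/
def map (g : QuadraticLieAlgebra V) (e : V ≃ₗ[ℂ] W) : QuadraticLieAlgebra W where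
  form := g.form.compl₁₂ e.symm.toLinearMap e.symm.toLinearMap
  form_symm := ⟨fun _ _ => g.form_symm.eq _ _⟩
  form_nondegenerate := by
    constructor
    · intro x hx
      have : e.symm x = 0 := g.form_nondegenerate.1 _ fun y => by simpa using hx (e y)
      simpa using this
    · intro x hx
      have : e.symm x = 0 := g.form_nondegenerate.2 _ fun y => by simpa using hx (e y)
      simpa using this
  bracket := (g.bracket.compl₁₂ e.symm.toLinearMap e.symm.toLinearMap).compr₂ e.toLinearMap
  bracket_self x := by simp [g.bracket_self]
  jacobi x y z := by simp [g.jacobi (e.symm x)]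
  invariant x y z := by simp [g.invariant]

theorem iIsomorphic_map (g : QuadraticLieAlgebra V) (e : V ≃ₗ[ℂ] W) : g.IIsomorphic (g.map e) :=
  iIsomorphic_iff.2 ⟨e, fun x y => by simp [map], fun x y => by simp [map]⟩

end Isomorphism

/-! ### Lower central series and nilpotency. -/

section LowerSeries

/-- The terms of the lower central series, as subspaces. -/
def lowerSeries (g : QuadraticLieAlgebra V) : ℕ → Submodule ℂ V
  | 0 => ⊤
  | k + 1 => Submodule.map₂ g.bracket ⊤ (lowerSeries g k)

theorem bracket_mem_lowerSeries (g : QuadraticLieAlgebra V) {k : ℕ} (x : V) {y : V}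
    (hy : y ∈ g.lowerSeries k) : g.bracket x y ∈ g.lowerSeries (k + 1) :=
  Submodule.apply_mem_map₂ _ Submodule.mem_top hy

theorem map_lowerSeries {g : QuadraticLieAlgebra V} {h : QuadraticLieAlgebra W} (e : V ≃ₗ[ℂ] W)
    (he : ∀ x y, e (g.bracket x y) = h.bracket (e x) (e y)) (k : ℕ) :
    (g.lowerSeries k).map e.toLinearMap = h.lowerSeries k := by
  induction k with
  | zero => simp [lowerSeries]
  | succ k ih =>
    have h1 : g.bracket.compr₂ e.toLinearMap =
        h.bracket.compl₁₂ e.toLinearMap e.toLinearMap := by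
      ext x y
      exact he x y
    have h2 : (⊤ : Submodule ℂ V).map e.toLinearMap = ⊤ := by simp
    rw [lowerSeries, lowerSeries, Submodule.map_map₂, h1, ← Submodule.map₂_map_map, ih, h2]

theorem coe_lowerCentralSeries (g : QuadraticLieAlgebra V) (k : ℕ) :
    LieSubmodule.toSubmodule (LieModule.lowerCentralSeries ℂ g.Carrier g.Carrier k) =
      g.lowerSeries k := by
  induction k with
  | zero => rfl
  | succ k ih =>
    rw [LieModule.lowerCentralSeries_succ]
    refine (LieSubmodule.lieIdeal_oper_eq_linear_span' ..).trans ?_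
    rw [lowerSeries, Submodule.map₂_eq_span_image2, ← ih]
    rfl

theorem isNilpotent_iff (g : QuadraticLieAlgebra V) :
    LieRing.IsNilpotent g.Carrier ↔ ∃ k, g.lowerSeries k = ⊥ := by
  rw [LieRing.IsNilpotent, LieModule.isNilpotent_iff ℂ]
  refine exists_congr fun k => ?_
  rw [← LieSubmodule.toSubmodule_eq_bot, coe_lowerCentralSeries]
  rfl

theorem isNilpotent_of_iIsomorphic {g : QuadraticLieAlgebra V} {h : QuadraticLieAlgebra W}
    (H : g.IIsomorphic h) (hg : LieRing.IsNilpotent g.Carrier) :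
    LieRing.IsNilpotent h.Carrier := by
  rw [isNilpotent_iff] at hg ⊢
  obtain ⟨e, he, -⟩ := iIsomorphic_iff.1 H
  obtain ⟨k, hk⟩ := hg
  exact ⟨k, by rw [← map_lowerSeries e he, hk, Submodule.map_bot]⟩

theorem isNilpotent_bracket {g : QuadraticLieAlgebra V} (hg : LieRing.IsNilpotent g.Carrier)
    (x : V) : IsNilpotent (g.bracket x : Module.End ℂ V) := by
  obtain ⟨k, hk⟩ := g.isNilpotent_iff.1 hg
  have key : ∀ k y, ((g.bracket x : Module.End ℂ V) ^ k) y ∈ g.lowerSeries k := by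
    intro k y
    induction k with
    | zero => exact Submodule.mem_top
    | succ k ih =>
      rw [pow_succ', Module.End.mul_apply]
      exact g.bracket_mem_lowerSeries x ih
  refine ⟨k, LinearMap.ext fun y => ?_⟩
  simpa [hk] using key k y

/-- A non-zero ideal of a nilpotent Lie algebra contains a non-zero central element. -/
theorem exists_central_mem {g : QuadraticLieAlgebra V} (hg : LieRing.IsNilpotent g.Carrier)
    {p : V → Prop} (hp : ∀ w x, p x → p (g.bracket w x)) {x : V} (hx : x ≠ 0) (hpx : p x) :
    ∃ z, z ≠ 0 ∧ p z ∧ ∀ w, g.bracket w z = 0 := by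
  obtain ⟨k, hk⟩ := g.isNilpotent_iff.1 hg
  by_contra! H
  -- If no such central element exists, bracketing can be repeated forever without reaching zero,
  -- giving non-zero elements in every term of the series. Only stability of p under brackets is
  -- needed, not linearity.
  have key : ∀ k, ∃ z ∈ g.lowerSeries k, z ≠ 0 ∧ p z := by
    intro k
    induction k with
    | zero => exact ⟨x, Submodule.mem_top, hx, hpx⟩
    | succ k ih =>
      obtain ⟨z, hzk, hz, hpz⟩ := ih
      obtain ⟨w, hw⟩ := H z hz hpz
      exact ⟨_, g.bracket_mem_lowerSeries w hzk, hw, hp w z hpz⟩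
  obtain ⟨z, hzk, hz, -⟩ := key k
  rw [hk, Submodule.mem_bot] at hzk
  exact hz hzk

end LowerSeries

/-! ### Singular algebras and the hyperbolic pair. -/

section Singular

/-- The linear form `α = B(x, ·)` satisfies `α ∧ I = 0`. -/
def WedgeVanishes (g : QuadraticLieAlgebra V) (x : V) : Prop :=
  ∀ a b c d, g.form x a * g.form (g.bracket b c) d - g.form x b * g.form (g.bracket a c) d +
    g.form x c * g.form (g.bracket a b) d - g.form x d * g.form (g.bracket a b) c = 0

theorem wedgeThreeForm_form_eq_zero_iff (g : QuadraticLieAlgebra V) (x : V) :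
    wedgeThreeForm g.threeForm (g.form x) = 0 ↔ g.WedgeVanishes x := by
  have key : ∀ v : Fin 4 → V, wedgeThreeForm g.threeForm (g.form x) v =
      g.form x (v 0) * g.form (g.bracket (v 1) (v 2)) (v 3) -
      g.form x (v 1) * g.form (g.bracket (v 0) (v 2)) (v 3) +
      g.form x (v 2) * g.form (g.bracket (v 0) (v 1)) (v 3) -
      g.form x (v 3) * g.form (g.bracket (v 0) (v 1)) (v 2) := by
    intro v
    change AlternatingMap.alternatizeUncurryFin ((g.form x).smulRight g.threeForm) v = _
    rw [AlternatingMap.alternatizeUncurryFin_apply, Fin.sum_univ_four]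
    simp [threeForm, Fin.removeNth, Fin.succAbove]
    rfl
  constructor
  · intro h a b c d
    have := key ![a, b, c, d]
    rw [h] at this
    simpa using this.symm
  · intro h
    ext v
    rw [key, h]
    rfl

theorem isLieAbelian_iff (g : QuadraticLieAlgebra V) :
    IsLieAbelian g.Carrier ↔ ∀ x y, g.bracket x y = 0 :=
  ⟨fun h x y => h.trivial (x : g.Carrier) y, fun h => ⟨h⟩⟩

theorem isSingular_iff [FiniteDimensional ℂ V] (g : QuadraticLieAlgebra V) :
    g.IsSingular ↔ (∃ x y, g.bracket x y ≠ 0) ∧ ∃ x, x ≠ 0 ∧ g.WedgeVanishes x := by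
  rw [IsSingular, isLieAbelian_iff, dup, Nat.one_le_iff_ne_zero, ne_eq (Module.finrank _ _),
    Submodule.finrank_eq_zero, ← ne_eq, Submodule.ne_bot_iff]
  push Not
  refine and_congr_right fun _ => ?_
  constructor
  · rintro ⟨α, hα, h0⟩
    obtain ⟨x, rfl⟩ := (g.form.toDual g.form_nondegenerate).surjective α
    refine ⟨x, fun hx => h0 (by rw [hx, map_zero]), ?_⟩
    rw [← wedgeThreeForm_form_eq_zero_iff]
    exact hα
  · rintro ⟨x, hx, h⟩
    refine ⟨g.form x, (wedgeThreeForm_form_eq_zero_iff g x).2 h, fun h0 => hx ?_⟩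
    exact g.form_nondegenerate.1 x fun y => by rw [h0]; rfl

theorem isSingular_of_iIsomorphic [FiniteDimensional ℂ V] [FiniteDimensional ℂ W]
    {g : QuadraticLieAlgebra V} {h : QuadraticLieAlgebra W} (H : g.IIsomorphic h)
    (hg : g.IsSingular) : h.IsSingular := by
  rw [isSingular_iff] at hg ⊢
  obtain ⟨e, he, hB⟩ := iIsomorphic_iff.1 H
  obtain ⟨⟨x, y, hxy⟩, z, hz, hzI⟩ := hg
  refine ⟨⟨e x, e y, by rwa [← he, ne_eq, e.map_eq_zero_iff]⟩, e z, by simpa using hz, ?_⟩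
  intro a b c d
  obtain ⟨a, rfl⟩ := e.surjective a
  obtain ⟨b, rfl⟩ := e.surjective b
  obtain ⟨c, rfl⟩ := e.surjective c
  obtain ⟨d, rfl⟩ := e.surjective d
  simp only [← he, hB]
  exact hzI a b c d

/-- The derivation ad w annihilates I, so applying it to α ∧ I = 0 leaves (w · α) ∧ I = 0. -/
theorem WedgeVanishes.bracket {g : QuadraticLieAlgebra V} {x : V} (hx : g.WedgeVanishes x)
    (w : V) : g.WedgeVanishes (g.bracket w x) := by
  intro a b c d
  have hα : ∀ u, g.form (g.bracket w x) u = -g.form x (g.bracket w u) := fun u => by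
    rw [g.bracket_swap, map_neg, LinearMap.neg_apply, g.invariant]
  have hI : ∀ u v z, g.form (g.bracket (g.bracket w u) v) z +
      g.form (g.bracket u (g.bracket w v)) z + g.form (g.bracket u v) (g.bracket w z) = 0 := by
    intro u v z
    have h1 := g.jacobi w u v
    have h2 : g.form (g.bracket u v) (g.bracket w z) =
        -g.form (g.bracket w (g.bracket u v)) z := by
      rw [← g.invariant, g.bracket_swap _ w, map_neg, LinearMap.neg_apply]
    rw [h2, h1, map_add, LinearMap.add_apply]
    ring
  simp only [hα]
  have ha := hx (g.bracket w a) b c d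
  have hb := hx a (g.bracket w b) c d
  have hc := hx a b (g.bracket w c) d
  have hd := hx a b c (g.bracket w d)
  linear_combination -ha - hb - hc - hd + g.form x a * hI b c d - g.form x b * hI a c d +
    g.form x c * hI a b d - g.form x d * hI a b c

/-- A nilpotent singular quadratic Lie algebra has a hyperbolic pair `(x, y)` with `x` central, such
that the bracket is determined by `x` and the skew map `ad y`. -/
theorem exists_hyperbolic_pair [FiniteDimensional ℂ V] {g : QuadraticLieAlgebra V}
    (hs : g.IsSingular) (hg : LieRing.IsNilpotent g.Carrier) :
    ∃ x y, g.form x x = 0 ∧ g.form y y = 0 ∧ g.form x y = 1 ∧ (∀ w, g.bracket w x = 0) ∧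
      ∀ u v, g.bracket u v = g.form x u • g.bracket y v - g.form x v • g.bracket y u +
        g.form (g.bracket y u) v • x := by
  obtain ⟨⟨a, b, hab⟩, x₀, hx₀, hw₀⟩ := (isSingular_iff g).1 hs
  obtain ⟨x, hx, hw, hc⟩ := exists_central_mem hg (fun w x hx => hx.bracket w) hx₀ hw₀
  have hc' : ∀ w, g.bracket x w = 0 := fun w => by rw [g.bracket_swap, hc, neg_zero]
  have hxx : g.form x x = 0 := by
    by_contra hxx
    refine hab (g.form_nondegenerate.1 _ fun d => ?_)
    have := hw x a b d
    -- With x itself in the first slot, centrality leaves only B(x, x) I(a, b, d) = 0; a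
    -- non-isotropic x would force [a, b] = 0.
    simp only [hc', map_zero, LinearMap.zero_apply, mul_zero, sub_zero, add_zero] at this
    exact (mul_eq_zero.1 this).resolve_left hxx
  obtain ⟨y₀, hy₀⟩ : ∃ y, g.form x y ≠ 0 := by
    by_contra! h
    exact hx (g.form_nondegenerate.1 _ h)
  set y₁ := (g.form x y₀)⁻¹ • y₀ with hy₁
  have hxy₁ : g.form x y₁ = 1 := by
    rw [hy₁, map_smul, smul_eq_mul, inv_mul_cancel₀ hy₀]
  have hyx₁ : g.form y₁ x = 1 := by rw [g.form_symm.eq, hxy₁]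
  set y := y₁ - (g.form y₁ y₁ / 2) • x with hy
  have hxy : g.form x y = 1 := by simp [hy, hxy₁, hxx]
  refine ⟨x, y, hxx, ?_, hxy, hc, fun u v => ?_⟩
  · simp [hy, hxy₁, hxx, hyx₁]
    ring
  · rw [← sub_eq_zero]
    refine g.form_nondegenerate.1 _ fun w => ?_
    -- Since B(x, y) = 1, placing y in the first slot solves α ∧ I = 0 for I(u, v, w).
    have := hw y u v w
    rw [hxy] at this
    simp only [map_sub, map_add, map_smul, LinearMap.sub_apply, LinearMap.add_apply,
      LinearMap.smul_apply, smul_eq_mul]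
    linear_combination this

end Singular

/-! ### Double extensions: lower central series and reconstruction. -/

section DoubleExtension

theorem apply_skewAdjoint {B : BilinForm ℂ V} (C : B.skewAdjointSubmodule) (x y : V) :
    B (C.1 x) y = -B x (C.1 y) := by
  simpa using (LinearMap.mem_skewAdjointSubmodule C.1).1 C.2 x y

variable {B : BilinForm ℂ V} {hs : B.IsSymm} {hn : B.Nondegenerate} (C : B.skewAdjointSubmodule)

theorem doubleExtension_bracket_apply (x y : V × ℂ × ℂ) :
    (doubleExtension B hs hn C).bracket x y =
      (x.2.2 • C.1 y.1 - y.2.2 • C.1 x.1, B (C.1 x.1) y.1, 0) := rfl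

theorem doubleExtension_form_apply (x y : V × ℂ × ℂ) :
    (doubleExtension B hs hn C).form x y = B x.1 y.1 + x.2.1 * y.2.2 + x.2.2 * y.2.1 := rfl

/-- One step of the series, phrased to cover both M = ⊤ with k = 0, where Y₁-components occur, and
the later terms, where they vanish; `h₂` is the condition common to both. -/
theorem map₂_bracket_doubleExtension {k : ℕ} {M : Submodule ℂ (V × ℂ × ℂ)}
    (h₁ : ∀ m ∈ M, m.1 ∈ LinearMap.range (C.1 ^ k))
    (h₂ : ∀ m ∈ M, ∀ x, m.2.2 • C.1 x ∈ LinearMap.range (C.1 ^ (k + 1)))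
    (h₃ : ∀ x, ((C.1 ^ k) x, 0, 0) ∈ M) :
    (C.1 ^ (k + 1) ≠ 0 → Submodule.map₂ (doubleExtension B hs hn C).bracket ⊤ M =
      (LinearMap.range (C.1 ^ (k + 1))).prod (Submodule.prod ⊤ ⊥)) ∧
    (C.1 ^ (k + 1) = 0 → Submodule.map₂ (doubleExtension B hs hn C).bracket ⊤ M = ⊥) := by
  have hC : ∀ m ∈ M, C.1 m.1 ∈ LinearMap.range (C.1 ^ (k + 1)) := by
    intro m hm
    obtain ⟨z, hz⟩ := h₁ m hm
    exact ⟨z, by rw [pow_succ', Module.End.mul_apply, hz]⟩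
  constructor
  · intro hk
    apply le_antisymm
    · rw [Submodule.map₂_le]
      intro x _ m hm
      rw [doubleExtension_bracket_apply]
      exact ⟨sub_mem (Submodule.smul_mem _ _ (hC m hm)) (h₂ m hm _), trivial, rfl⟩
    · obtain ⟨z, hz⟩ : ∃ z, (C.1 ^ (k + 1)) z ≠ 0 := by
        by_contra! h
        exact hk (LinearMap.ext h)
      obtain ⟨x, hx⟩ : ∃ x, B x ((C.1 ^ (k + 1)) z) ≠ 0 := by
        by_contra! h
        exact hz (hn.2 _ h)
      -- The bracket of x with C^k z is the multiple -B(x, C^(k+1) z) of X₁, non-zero by the choice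
      -- of x.
      have hX : ((0 : V), (1 : ℂ), (0 : ℂ)) ∈
          Submodule.map₂ (doubleExtension B hs hn C).bracket ⊤ M := by
        have h := Submodule.smul_mem _ (-B x ((C.1 ^ (k + 1)) z))⁻¹
          (Submodule.apply_mem_map₂ (doubleExtension B hs hn C).bracket
            (Submodule.mem_top (x := (x, 0, 0))) (h₃ z))
        rw [doubleExtension_bracket_apply] at h
        simp only [apply_skewAdjoint, ← Module.End.mul_apply, ← pow_succ'] at h
        simpa [hx] using h
      rintro ⟨v, a, b⟩ ⟨⟨w, hw⟩, -, hb⟩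
      obtain rfl : b = 0 := hb
      obtain rfl : (C.1 ^ (k + 1)) w = v := hw
      have h := Submodule.apply_mem_map₂ (doubleExtension B hs hn C).bracket
            (Submodule.mem_top (x := (0, 0, 1))) (h₃ w)
      rw [doubleExtension_bracket_apply] at h
      convert add_mem h (Submodule.smul_mem _ a hX) using 1
      simp [pow_succ']
  · intro hk
    rw [eq_bot_iff, Submodule.map₂_le]
    intro x _ m hm
    rw [doubleExtension_bracket_apply, apply_skewAdjoint]
    have e₁ := hC m hm
    have e₂ := h₂ m hm x.1
    rw [hk, LinearMap.range_zero, Submodule.mem_bot] at e₁ e₂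
    simp [e₁, e₂]

theorem lowerSeries_doubleExtension (k : ℕ) :
    (C.1 ^ (k + 1) ≠ 0 → (doubleExtension B hs hn C).lowerSeries (k + 1) =
      (LinearMap.range (C.1 ^ (k + 1))).prod (Submodule.prod ⊤ ⊥)) ∧
    (C.1 ^ (k + 1) = 0 → (doubleExtension B hs hn C).lowerSeries (k + 1) = ⊥) := by
  induction k with
  | zero =>
    apply map₂_bracket_doubleExtension
    · simp
    · exact fun m _ x => ⟨m.2.2 • x, by simp⟩
    · exact fun _ => Submodule.mem_top
  | succ k ih =>
    by_cases hk : C.1 ^ (k + 1) = 0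
    · have hk' : C.1 ^ (k + 1 + 1) = 0 := by rw [pow_succ, hk, zero_mul]
      refine ⟨fun h => absurd hk' h, fun _ => ?_⟩
      rw [lowerSeries, ih.2 hk, Submodule.map₂_bot_right]
    · rw [lowerSeries, ih.1 hk]
      apply map₂_bracket_doubleExtension
      · exact fun m hm => hm.1
      · intro m hm x
        have : m.2.2 = 0 := hm.2.2
        rw [this, zero_smul]
        exact zero_mem _
      · exact fun x => ⟨⟨x, rfl⟩, trivial, rfl⟩

theorem finrank_lowerSeries_doubleExtension [FiniteDimensional ℂ V] (k : ℕ) :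
    Module.finrank ℂ ((doubleExtension B hs hn C).lowerSeries (k + 1)) =
      if Module.finrank ℂ (LinearMap.range (C.1 ^ (k + 1))) = 0 then 0
      else Module.finrank ℂ (LinearMap.range (C.1 ^ (k + 1))) + 1 := by
  by_cases h : C.1 ^ (k + 1) = 0
  · rw [(lowerSeries_doubleExtension C k).2 h, finrank_bot,
      if_pos (pow_eq_zero_iff_of_finrank_range.1 h)]
  · rw [(lowerSeries_doubleExtension C k).1 h, finrank_submodule_prod, finrank_submodule_prod,
      finrank_top, finrank_bot, Module.finrank_self,
      if_neg (mt pow_eq_zero_iff_of_finrank_range.2 h)]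

theorem isNilpotent_doubleExtension (h : IsNilpotent C.1) :
    LieRing.IsNilpotent (doubleExtension B hs hn C).Carrier := by
  obtain ⟨k, hk⟩ := h
  rw [isNilpotent_iff]
  exact ⟨k + 1, (lowerSeries_doubleExtension C k).2 (by rw [pow_succ, hk, zero_mul])⟩

/-- The form α = B(X₁, ·) reads off the Y₁-coordinate, and I is α wedged with the 2-form B(C ·, ·);
hence α ∧ I = 0. -/
theorem isSingular_doubleExtension [FiniteDimensional ℂ V] (h : C ≠ 0) :
    (doubleExtension B hs hn C).IsSingular := by
  rw [isSingular_iff]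
  constructor
  · obtain ⟨x, hx⟩ : ∃ x, C.1 x ≠ 0 := by
      by_contra! h'
      exact h (Subtype.ext (LinearMap.ext h'))
    refine ⟨(0, 0, 1), (x, 0, 0), fun h0 => hx ?_⟩
    simpa [doubleExtension_bracket_apply] using congrArg Prod.fst h0
  · refine ⟨(0, 1, 0), by simp, fun a b c d => ?_⟩
    simp only [doubleExtension_bracket_apply, doubleExtension_form_apply, map_sub, map_smul,
      LinearMap.sub_apply, LinearMap.smul_apply, smul_eq_mul, map_zero, LinearMap.zero_apply]
    ring

theorem iIsomorphic_doubleExtension_of_isometry {B' : BilinForm ℂ W} {hs' : B'.IsSymm}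
    {hn' : B'.Nondegenerate} {C : B.skewAdjointSubmodule} {C' : B'.skewAdjointSubmodule}
    (U : V ≃ₗ[ℂ] W) (hU : ∀ x y, B' (U x) (U y) = B x y) (hC : ∀ x, U (C.1 x) = C'.1 (U x)) :
    (doubleExtension B hs hn C).IIsomorphic (doubleExtension B' hs' hn' C') := by
  rw [iIsomorphic_iff]
  refine ⟨U.prodCongr (LinearEquiv.refl ℂ (ℂ × ℂ)), fun x y => ?_, fun x y => ?_⟩
  · simp [doubleExtension_bracket_apply, ← hC, hU]
  · simp [doubleExtension_form_apply, hU]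

/-- Every nilpotent singular quadratic Lie algebra is a double extension. -/
theorem exists_iIsomorphic_doubleExtension [FiniteDimensional ℂ V] [FiniteDimensional ℂ W]
    {g : QuadraticLieAlgebra W} (hg : g.IsSingular) (hgn : LieRing.IsNilpotent g.Carrier)
    (hd : Module.finrank ℂ W = Module.finrank ℂ V + 2) :
    ∃ C : B.skewAdjointSubmodule, C ≠ 0 ∧ IsNilpotent C.1 ∧
      g.IIsomorphic (doubleExtension B hs hn C) := by
  obtain ⟨x, y, hxx, hyy, hxy, hc, hbr⟩ := exists_hyperbolic_pair hg hgn
  have hyx : g.form y x = 1 := by rw [g.form_symm.eq, hxy]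
  let P : Submodule ℂ W := LinearMap.ker (g.form x) ⊓ LinearMap.ker (g.form y)
  have hPx : ∀ u : P, g.form x u = 0 := fun u => u.2.1
  have hPy : ∀ u : P, g.form y u = 0 := fun u => u.2.2
  have hPx' : ∀ u : P, g.form u x = 0 := fun u => by rw [g.form_symm.eq, hPx]
  have hPy' : ∀ u : P, g.form u y = 0 := fun u => by rw [g.form_symm.eq, hPy]
  let π : W →ₗ[ℂ] P := LinearMap.codRestrict P
    (LinearMap.id - (g.form y).smulRight x - (g.form x).smulRight y) fun w => by
      simp [P, hxx, hyy, hxy, hyx]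
  have hπ : ∀ w, (π w : W) = w - g.form y w • x - g.form x w • y := fun w => rfl
  let e : W ≃ₗ[ℂ] P × ℂ × ℂ := LinearEquiv.ofLinearMap
    (π.prod ((g.form y).prod (g.form x)))
    (P.subtype.coprod ((LinearMap.toSpanSingleton ℂ W x).coprod (LinearMap.toSpanSingleton ℂ W y)))
    (by
      refine LinearMap.ext fun ⟨u, a, b⟩ => Prod.ext (Subtype.ext ?_) (Prod.ext ?_ ?_)
      · simp [hπ, hPx, hPy, hxx, hyy, hxy, hyx]
      · simp [hPy, hyy, hyx]
      · simp [hPx, hxx, hxy])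
    (by
      refine LinearMap.ext fun w => ?_
      simp [hπ])
  have he : ∀ u a b, e.symm (u, a, b) = u + (a • x + b • y) := fun u a b => rfl
  let B₀ : BilinForm ℂ P := g.form.restrict P
  have hB₀ : ∀ u v, B₀ u v = g.form u v := fun u v => rfl
  have hs₀ : B₀.IsSymm := ⟨fun u v => g.form_symm.eq _ _⟩
  have hsep : ∀ u, (∀ v, B₀ u v = 0) → u = 0 := by
    intro u hu
    refine Subtype.ext (g.form_nondegenerate.1 _ fun w => ?_)
    obtain ⟨⟨v, a, b⟩, rfl⟩ := e.symm.surjective w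
    have := hu v
    rw [hB₀] at this
    simp [he, this, hPx', hPy']
  have hn₀ : B₀.Nondegenerate := ⟨hsep, fun v hv => hsep v fun u => by rw [hs₀.eq, hv]⟩
  have hdim : Module.finrank ℂ P = Module.finrank ℂ V := by
    have := e.finrank_eq
    rw [Module.finrank_prod, Module.finrank_prod, Module.finrank_self, hd] at this
    omega
  obtain ⟨φ, hφ⟩ := exists_isometry_of_finrank_eq hs₀ hn₀ hs hn hdim
  -- Orthogonality to x comes from centrality of x, orthogonality to y from [y, y] = 0.
  have hmem : ∀ u ∈ P, g.bracket y u ∈ P := fun u _ => by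
    refine ⟨?_, ?_⟩
    · change _ = _
      rw [← g.invariant, g.bracket_swap, hc, neg_zero, map_zero,
        LinearMap.zero_apply]
    · change _ = _
      rw [← g.invariant, g.bracket_self, map_zero, LinearMap.zero_apply]
  let D : Module.End ℂ P := LinearMap.restrict (g.bracket y) hmem
  have hD : ∀ u, (D u : W) = g.bracket y u := fun u => rfl
  have hDs : ∀ u v, B₀ (D u) v = -B₀ u (D v) := fun u v => by
    rw [hB₀, hB₀, hD, hD, g.bracket_swap, map_neg, LinearMap.neg_apply, g.invariant]
  let C : B.skewAdjointSubmodule := ⟨φ.conj D, by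
    rw [LinearMap.mem_skewAdjointSubmodule]
    intro u v
    obtain ⟨u, rfl⟩ := φ.surjective u
    obtain ⟨v, rfl⟩ := φ.surjective v
    simp [LinearEquiv.conj_apply, hφ, hDs]⟩
  have hC : ∀ u, C.1 (φ u) = φ (D u) := fun u => by simp [C, LinearEquiv.conj_apply]
  have hiso : g.IIsomorphic (doubleExtension B hs hn C) := by
    apply IIsomorphic.symm
    rw [iIsomorphic_iff]
    refine ⟨(φ.symm.prodCongr (LinearEquiv.refl ℂ (ℂ × ℂ))).trans e.symm, ?_, ?_⟩
    · rintro ⟨u, a, b⟩ ⟨v, a', b'⟩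
      obtain ⟨u, rfl⟩ := φ.surjective u
      obtain ⟨v, rfl⟩ := φ.surjective v
      have h1 := hbr (u + (a • x + b • y)) (v + (a' • x + b' • y))
      have h2 : g.form (g.bracket y u) x = 0 := by rw [g.invariant, hc, map_zero]
      have h3 : g.form (g.bracket y u) y = 0 := hPy' (D u)
      simp only [doubleExtension_bracket_apply, LinearEquiv.trans_apply,
        LinearEquiv.prodCongr_apply, LinearEquiv.refl_apply, LinearEquiv.symm_apply_apply, he, hC,
        hφ, map_sub, map_smul, hB₀, hD, Submodule.coe_sub, Submodule.coe_smul]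
      rw [h1]
      simp [hc, hPx, hxx, hxy, h2, h3, g.bracket_self]
    · rintro ⟨u, a, b⟩ ⟨v, a', b'⟩
      obtain ⟨u, rfl⟩ := φ.surjective u
      obtain ⟨v, rfl⟩ := φ.surjective v
      simp [doubleExtension_form_apply, he, hφ, hB₀, hPx, hPy, hPx', hPy', hxx, hyy, hxy, hyx]
      ring
  refine ⟨C, fun h0 => ?_, ?_, hiso⟩
  · obtain ⟨f, hf, -⟩ := iIsomorphic_iff.1 hiso
    obtain ⟨⟨u, v, huv⟩, -⟩ := (isSingular_iff g).1 hg
    refine huv (f.injective ?_)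
    rw [hf, h0, doubleExtension_bracket_apply]
    simp
  · obtain ⟨k, hk⟩ := isNilpotent_bracket hgn y
    refine ⟨k, LinearMap.ext fun v => ?_⟩
    obtain ⟨u, rfl⟩ := φ.surjective v
    have h1 : (D ^ k) u = 0 := by
      have := map_pow_of_intertwines P.subtype (C := D) (D := g.bracket y) (fun _ => rfl) k u
      rw [hk, LinearMap.zero_apply] at this
      simpa using this
    rw [← map_pow_of_intertwines φ (fun u => (hC u).symm), h1, map_zero, LinearMap.zero_apply]

end DoubleExtension

end QuadraticLieAlgebra

/-! ### Orbits, isomorphism classes and finiteness. -/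

open QuadraticLieAlgebra

theorem mem_adjointOrbit_iff {n : ℕ} {C C' : (canonicalForm n).skewAdjointSubmodule} :
    C' ∈ adjointOrbit n C ↔ ∃ U : (Fin n → ℂ) ≃ₗ[ℂ] (Fin n → ℂ),
      (∀ x y, canonicalForm n (U x) (U y) = canonicalForm n x y) ∧
      ∀ x, U (C.1 x) = C'.1 (U x) := by
  refine exists_congr fun U => and_congr_right fun _ => ⟨fun h x => ?_, fun h => ?_⟩
  · rw [h]
    simp
  · refine LinearMap.ext fun x => ?_
    simp [h]

theorem mem_adjointOrbit_self {n : ℕ} (C : (canonicalForm n).skewAdjointSubmodule) :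
    C ∈ adjointOrbit n C :=
  mem_adjointOrbit_iff.2 ⟨LinearEquiv.refl ℂ _, fun _ _ => rfl, fun _ => rfl⟩

theorem mem_adjointOrbit_of_finrank_range_pow_eq {n : ℕ}
    {C C' : (canonicalForm n).skewAdjointSubmodule} (hC : IsNilpotent C.1)
    (h : ∀ k, Module.finrank ℂ (LinearMap.range (C.1 ^ k)) =
      Module.finrank ℂ (LinearMap.range (C'.1 ^ k))) : C' ∈ adjointOrbit n C := by
  obtain ⟨P, hP⟩ := exists_similar_of_finrank_range_pow_eq hC h
  exact mem_adjointOrbit_iff.2 (exists_isometry_of_similar (canonicalForm_isSymm n)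
    (canonicalForm_nondegenerate n) (apply_skewAdjoint C) (apply_skewAdjoint C') P hP)

theorem iIsomorphic_of_mem_adjointOrbit {n : ℕ} {C C' : (canonicalForm n).skewAdjointSubmodule}
    (h : C' ∈ adjointOrbit n C) : (doubleExtensionOf n C).IIsomorphic (doubleExtensionOf n C') := by
  obtain ⟨U, hU, hC⟩ := mem_adjointOrbit_iff.1 h
  exact iIsomorphic_doubleExtension_of_isometry U hU hC

/-- A Lie isomorphism preserves the dimensions of the lower central series, and the rule sending 0
to 0 and r > 0 to r + 1 is injective, so every rank is recovered. -/
theorem mem_adjointOrbit_of_isomorphic {n : ℕ} {C C' : (canonicalForm n).skewAdjointSubmodule}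
    (hC : IsNilpotent C.1) (h : (doubleExtensionOf n C).Isomorphic (doubleExtensionOf n C')) :
    C' ∈ adjointOrbit n C := by
  refine mem_adjointOrbit_of_finrank_range_pow_eq hC fun k => ?_
  cases k with
  | zero => rw [pow_zero, pow_zero]
  | succ k =>
    obtain ⟨e, he⟩ := isomorphic_iff.1 h
    have h1 : Module.finrank ℂ ((doubleExtensionOf n C').lowerSeries (k + 1)) =
        Module.finrank ℂ ((doubleExtensionOf n C).lowerSeries (k + 1)) := by
      rw [← map_lowerSeries e he]
      exact LinearEquiv.finrank_map_eq e _
    unfold doubleExtensionOf at h1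
    rw [finrank_lowerSeries_doubleExtension, finrank_lowerSeries_doubleExtension] at h1
    split_ifs at h1 <;> omega

theorem adjointOrbit_eq_of_mem {n : ℕ} {C C' : (canonicalForm n).skewAdjointSubmodule}
    (h : C' ∈ adjointOrbit n C) : adjointOrbit n C' = adjointOrbit n C := by
  have aux : ∀ {C C' : (canonicalForm n).skewAdjointSubmodule}, C' ∈ adjointOrbit n C →
      adjointOrbit n C' ⊆ adjointOrbit n C := by
    intro C C' h C'' h'
    obtain ⟨U, hU, hC⟩ := mem_adjointOrbit_iff.1 h
    obtain ⟨U', hU', hC'⟩ := mem_adjointOrbit_iff.1 h'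
    exact mem_adjointOrbit_iff.2 ⟨U.trans U', fun x y => by simp [hU, hU'],
      fun x => by simp [hC, hC']⟩
  refine (aux h).antisymm (aux ?_)
  obtain ⟨U, hU, hC⟩ := mem_adjointOrbit_iff.1 h
  refine mem_adjointOrbit_iff.2 ⟨U.symm, fun x y => ?_, fun x => U.injective ?_⟩
  · rw [← hU, U.apply_symm_apply, U.apply_symm_apply]
  · simp [hC]

/-- The ranks of the powers of `C`. -/
def rankSequence {n : ℕ} (C : (canonicalForm n).skewAdjointSubmodule) (k : Fin n) : Fin (n + 1) :=
  ⟨Module.finrank ℂ (LinearMap.range (C.1 ^ (k : ℕ))), by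
    have := (LinearMap.range (C.1 ^ (k : ℕ))).finrank_le
    rw [Module.finrank_fin_fun] at this
    omega⟩

theorem finite_nilpotentOrbits (n : ℕ) : (NilpotentOrbits n).Finite := by
  have hrep : ∀ O : NilpotentOrbits n, ∃ C ∈ NonzeroNilpotents n, adjointOrbit n C = O :=
    fun O => O.2
  choose c hc hcO using hrep
  -- By Cayley–Hamilton a nilpotent map has zero n-th power, so the exponents below n recorded by
  -- `rankSequence` suffice.
  have hpow : ∀ O k, n ≤ k → (c O).1 ^ k = 0 := fun O k hk =>
    by
    have h := (c O).1.aeval_self_charpoly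
    rw [(hc O).2.charpoly_eq_X_pow_finrank, Module.finrank_fin_fun, map_pow,
      Polynomial.aeval_X] at h
    exact pow_eq_zero_of_le hk h
  refine Set.finite_coe_iff.1 (Finite.of_injective (fun O => rankSequence (c O)) fun O O' h => ?_)
  refine Subtype.ext ?_
  rw [← hcO O, ← hcO O']
  refine (adjointOrbit_eq_of_mem
    (mem_adjointOrbit_of_finrank_range_pow_eq (hc O).2 fun k => ?_)).symm
  rcases lt_or_ge k n with hk | hk
  · exact congrArg Fin.val (congrFun h ⟨k, hk⟩)
  · rw [hpow O k hk, hpow O' k hk]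

theorem exists_realization {n : ℕ} {C : (canonicalForm n).skewAdjointSubmodule}
    (hC : C ∈ NonzeroNilpotents n) :
    ∃ g : NilpotentSingular (n + 2), g.1.IIsomorphic (doubleExtensionOf n C) := by
  obtain ⟨e, he⟩ := exists_isometry_of_finrank_eq (doubleExtensionOf n C).form_symm
    (doubleExtensionOf n C).form_nondegenerate (canonicalForm_isSymm (n + 2))
    (canonicalForm_nondegenerate (n + 2)) (by simp)
  have h := (doubleExtensionOf n C).iIsomorphic_map e
  refine ⟨⟨(doubleExtensionOf n C).map e, ?_, isSingular_of_iIsomorphic h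
    (isSingular_doubleExtension C hC.1), isNilpotent_of_iIsomorphic h
    (isNilpotent_doubleExtension C hC.2)⟩, h.symm⟩
  refine LinearMap.ext₂ fun x y => ?_
  change (doubleExtensionOf n C).form (e.symm x) (e.symm y) = _
  rw [← he, e.apply_symm_apply, e.apply_symm_apply]

theorem exists_nonzeroNilpotent {n : ℕ} (g : NilpotentSingular (n + 2)) :
    ∃ C ∈ NonzeroNilpotents n, g.1.IIsomorphic (doubleExtensionOf n C) := by
  obtain ⟨C, h0, hn, h⟩ := exists_iIsomorphic_doubleExtension (hs := canonicalForm_isSymm n)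
    (hn := canonicalForm_nondegenerate n) g.2.2.1 g.2.2.2 (by simp)
  exact ⟨C, ⟨h0, hn⟩, h⟩

theorem isomorphic_iff_iIsomorphic {n : ℕ} (g g' : NilpotentSingular (n + 2)) :
    g.1.Isomorphic g'.1 ↔ g.1.IIsomorphic g'.1 := by
  refine ⟨fun h => ?_, IIsomorphic.isomorphic⟩
  obtain ⟨C, hC, hg⟩ := exists_nonzeroNilpotent g
  obtain ⟨C', hC', hg'⟩ := exists_nonzeroNilpotent g'
  have := mem_adjointOrbit_of_isomorphic hC.2
    ((hg.symm.isomorphic.trans h).trans hg'.isomorphic)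
  exact (hg.trans (iIsomorphic_of_mem_adjointOrbit this)).trans hg'.symm

theorem isoClass_eq_isoClass_iff {m : ℕ} {g g' : NilpotentSingular m} :
    isoClass g = isoClass g' ↔ g.1.Isomorphic g'.1 := by
  constructor
  · intro h
    have : g' ∈ isoClass g' := ⟨LieEquiv.refl⟩
    rwa [← h] at this
  · intro h
    ext f
    exact ⟨fun hf => h.symm.trans hf, fun hf => h.trans hf⟩

end

theorem proposition5p2 (n : ℕ) (hn : 1 ≤ n) :
    -- isomorphism and i-isomorphism coincide
    ((∀ g g' : NilpotentSingular (n + 2), g.1.Isomorphic g'.1 ↔ g.1.IIsomorphic g'.1) ∧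
      (∀ g : NilpotentSingular (n + 2), iIsoClass g = isoClass g) ∧
      IIsoClasses (n + 2) = IsoClasses (n + 2)) ∧
    -- every double extension by a non-zero nilpotent map is realized on `ℂⁿ⁺²`, and sending its
    -- orbit to the class of any realization is a well-defined bijection
    (∃ τ : NilpotentOrbits n → IsoClasses (n + 2), Function.Bijective τ ∧
      ∀ (C : (canonicalForm n).skewAdjointSubmodule) (hC : C ∈ NonzeroNilpotents n),
        (∃ g : NilpotentSingular (n + 2), g.1.IIsomorphic (doubleExtensionOf n C)) ∧
        ∀ g : NilpotentSingular (n + 2), g.1.IIsomorphic (doubleExtensionOf n C) →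
          (τ ⟨adjointOrbit n C, Set.mem_image_of_mem _ hC⟩ : Set (NilpotentSingular (n + 2))) =
            isoClass g) ∧
    (IsoClasses (n + 2)).Finite := by
  have hcl : ∀ g : NilpotentSingular (n + 2), iIsoClass g = isoClass g := fun g =>
    Set.ext fun g' => (isomorphic_iff_iIsomorphic g g').symm
  have hreal : ∀ O : NilpotentOrbits n, ∃ g : NilpotentSingular (n + 2), ∃ C ∈ NonzeroNilpotents n,
      adjointOrbit n C = O ∧ g.1.IIsomorphic (doubleExtensionOf n C) := by
    rintro ⟨_, C, hC, rfl⟩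
    obtain ⟨g, hg⟩ := exists_realization hC
    exact ⟨g, C, hC, rfl, hg⟩
  choose γ c hc hcO hγ using hreal
  let τ : NilpotentOrbits n → IsoClasses (n + 2) := fun O => ⟨isoClass (γ O), γ O, rfl⟩
  -- Independence of the choices made in τ: the chosen representative of the orbit is conjugate to
  -- C, so any two realizations are i-isomorphic.
  have hτ : ∀ (C : (canonicalForm n).skewAdjointSubmodule) (hC : C ∈ NonzeroNilpotents n)
      (g : NilpotentSingular (n + 2)), g.1.IIsomorphic (doubleExtensionOf n C) →
      (τ ⟨adjointOrbit n C, Set.mem_image_of_mem _ hC⟩ : Set (NilpotentSingular (n + 2))) =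
        isoClass g := by
    intro C hC g hg
    refine isoClass_eq_isoClass_iff.2 (((hγ _).trans ?_).trans hg.symm).isomorphic
    apply iIsomorphic_of_mem_adjointOrbit
    rw [hcO]
    exact mem_adjointOrbit_self C
  have hbij : Function.Bijective τ := by
    constructor
    · intro O O' h
      have h1 := isoClass_eq_isoClass_iff.1 (congrArg Subtype.val h)
      have h2 := mem_adjointOrbit_of_isomorphic (hc O).2
        (((hγ O).symm.isomorphic.trans h1).trans (hγ O').isomorphic)
      refine Subtype.ext ?_
      rw [← hcO O, ← hcO O', adjointOrbit_eq_of_mem h2]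
    · rintro ⟨_, g, rfl⟩
      obtain ⟨C, hC, hg⟩ := exists_nonzeroNilpotent g
      exact ⟨_, Subtype.ext (hτ C hC g hg)⟩
  refine ⟨⟨isomorphic_iff_iIsomorphic, hcl, ?_⟩,
    ⟨τ, hbij, fun C hC => ⟨exists_realization hC, hτ C hC⟩⟩, ?_⟩
  · rw [IIsoClasses, IsoClasses, funext hcl]
  · have := (finite_nilpotentOrbits n).to_subtype
    exact Set.finite_coe_iff.1 (Finite.of_surjective τ hbij.2)
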